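/- Let $k\ge 2$ and let $X^{(1)},\ldots,X^{(k)}$ be independent homogeneous Poisson point processes in $\mathbb{R}^3$ with intensities $\lambda_1,\ldots,\lambda_k>0$. For a locally finite set $\varphi\subset\mathbb{R}^3$ let $\mathrm{Rng}(\varphi)$ be its relative neighborhood graph: two distinct nodes $x,y\in\varphi$ are connected by an edge if and only if there is no $z\in\varphi\setminus\{x,y\}$ with $\max\{|x-z|,|y-z|\}\le|x-y|$. Identify $\mathrm{Rng}(\varphi)$ with the subset of $\mathbb{R}^3$ formed by its nodes and the line segments along its edges. Let $$\Xi=\Big\{x\in\mathbb{R}^3:\ \mathrm{dist}\big(x,\mathrm{Rng}(X^{(1)})\big)\le\min_{1\le j\le k}\mathrm{dist}\big(x,\mathrm{Rng}(X^{(j)})\big)\Big\}$$ be the Voronoi mollification of $\mathrm{Rng}(X^{(1)})$ with respect to $X^{(1)},\ldots,X^{(k)}$. For $A\subset\mathbb{R}^3$ and $r>0$ write $A^{\ominus r}=\{x: B(x,r)\subset A\}$ for the erosion and $\Psi_r(A)=A^{\ominus r}\oplus B(o,r)$ for the opening of $A$, where $B(x,r)$ is the closed ball of radius $r$ around $x$,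 $o$ is the origin and $\oplus$ is Minkowski addition. Then for all $0<r_1<r_2$ the set $\{o\in\Xi^{\ominus r_1}\setminus\Psi_{r_2}(\Xi)\}$ is an event (up to a null set) and $$\mathbb{P}\big(o\in\Xi^{\ominus r_1}\setminus\Psi_{r_2}(\Xi)\big)>0 .$$ -/

import Mathlib

open MeasureTheory ProbabilityTheory Set
open scoped NNReal ENNReal Pointwise

/-! ### Point configurations and Poisson point processes -/

/-- A locally finite set of points of `ℝ^d`. -/
structure PointConfig (d : ℕ) where
  /-- The underlying set of points. -/
  carrier : Set (EuclideanSpace ℝ (Fin d))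
  /-- Every compact set contains only finitely many of the points. -/
  locallyFinite : ∀ K : Set (EuclideanSpace ℝ (Fin d)), IsCompact K → (carrier ∩ K).Finite

/-- The number of points of `φ` in `B` (used for bounded `B`, where it is finite). -/
noncomputable def PointConfig.count {d : ℕ} (φ : PointConfig d)
    (B : Set (EuclideanSpace ℝ (Fin d))) : ℕ :=
  (φ.carrier ∩ B).ncard

/-- The σ-algebra on configurations generated by the numbers of points in bounded Borel sets. -/
noncomputable instance PointConfig.instMeasurableSpace (d : ℕ) : MeasurableSpace (PointConfig d) :=
  ⨆ B : {B : Set (EuclideanSpace ℝ (Fin d)) // MeasurableSet B ∧ Bornology.IsBounded B},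
    MeasurableSpace.comap (fun φ : PointConfig d => φ.count B.1) ⊤

/-- `X` is a homogeneous Poisson point process in `ℝ^d` with intensity `lam`: the number of points
in a bounded Borel set `B` is Poisson distributed with parameter `lam * vol B`, and the numbers of
points in pairwise disjoint bounded Borel sets are independent. -/
structure IsPoissonProcess {Ω : Type*} [MeasurableSpace Ω] {d : ℕ} (P : Measure Ω)
    (lam : ℝ≥0) (X : Ω → PointConfig d) : Prop where
  measurable : Measurable X
  hasLaw_count : ∀ B : Set (EuclideanSpace ℝ (Fin d)),
    MeasurableSet B → Bornology.IsBounded B →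
      HasLaw (fun ω => (X ω).count B) (poissonMeasure (lam * (volume B).toNNReal)) P
  iIndepFun_count : ∀ (n : ℕ) (B : Fin n → Set (EuclideanSpace ℝ (Fin d))),
    (∀ i, MeasurableSet (B i)) → (∀ i, Bornology.IsBounded (B i)) →
      Pairwise (fun i j => Disjoint (B i) (B j)) →
        iIndepFun (fun i ω => (X ω).count (B i)) P

/-! ### Relative neighborhood graphs and their Voronoi mollification -/

/-- The relative neighborhood graph on the vertex set `φ`: two distinct nodes `x`, `y` are joined
by an edge iff there is no `z ∈ φ \ {x, y}` with `max (|x - z|) (|y - z|) ≤ |x - y|`. -/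
def relNbhdGraph {d : ℕ} (φ : Set (EuclideanSpace ℝ (Fin d))) : SimpleGraph φ where
  Adj x y := x ≠ y ∧ ¬ ∃ z : φ, z ≠ x ∧ z ≠ y ∧ max (dist x z) (dist y z) ≤ dist x y
  symm := ⟨by
    rintro x y ⟨hne, h⟩
    refine ⟨hne.symm, ?_⟩
    rintro ⟨z, hzy, hzx, hz⟩
    exact h ⟨z, hzx, hzy, by rwa [max_comm, dist_comm x y]⟩⟩
  loopless := ⟨fun _ h => h.1 rfl⟩

/-- The relative neighborhood graph on `φ` as a subset of `ℝ^d`: the union of its nodes and of the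
line segments along its edges. -/
def relNbhdSet {d : ℕ} (φ : Set (EuclideanSpace ℝ (Fin d))) :
    Set (EuclideanSpace ℝ (Fin d)) :=
  φ ∪ ⋃ (x : φ) (y : φ) (_ : (relNbhdGraph φ).Adj x y),
    segment ℝ (x : EuclideanSpace ℝ (Fin d)) (y : EuclideanSpace ℝ (Fin d))

/-- The Voronoi mollification of the relative neighborhood graph on `Φ i` with respect to the
family `Φ`. The distance to the empty set is `∞`. -/
def voronoiMollification {d : ℕ} {ι : Type*} (i : ι)
    (Φ : ι → Set (EuclideanSpace ℝ (Fin d))) : Set (EuclideanSpace ℝ (Fin d)) :=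
  {x | Metric.infEDist x (relNbhdSet (Φ i)) ≤ ⨅ j, Metric.infEDist x (relNbhdSet (Φ j))}

/-! ### Erosion and opening -/

/-- The erosion of `A` by the closed ball of radius `r` around the origin. -/
def erosion {d : ℕ} (r : ℝ) (A : Set (EuclideanSpace ℝ (Fin d))) :
    Set (EuclideanSpace ℝ (Fin d)) :=
  {x | Metric.closedBall x r ⊆ A}

/-- The opening of `A` by the closed ball of radius `r`: the Minkowski sum of the erosion of `A`
and of the closed ball of radius `r` around the origin. -/
def opening {d : ℕ} (r : ℝ) (A : Set (EuclideanSpace ℝ (Fin d))) :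
    Set (EuclideanSpace ℝ (Fin d)) :=
  erosion r A + Metric.closedBall (0 : EuclideanSpace ℝ (Fin d)) r

/-! ### Counts of points -/

/-! Positivity comes from an explicit pattern that is stable under moving points by a small `ε`. All
processes but the first have their nodes in the ball of radius `r₁ + r₂` within `ε` of a finite net
of the sphere of that radius, which blocks every edge cutting deep into the ball
(`IsNearIn.le_norm_of_mem_relNbhdSet`). The first process has a node near the origin and blockers
that keep its graph, near the origin, within `ε` of the plane where coordinate `1` vanishes
(`IsNearIn.abs_apply_one_le_of_mem_relNbhdSet`).

The ball of radius `r₁` around the origin then lies in the mollification. A ball of radius `r₂`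
containing the origin has a point `z` with `|z 1| ≥ r₂` and `‖z‖ ≤ 2 * r₂`. This point is at
distance at least `r₂ - ε` from the first graph but closer to the sphere, so the ball is not
contained in the mollification. Such patterns have positive probability because counts in disjoint
sets, and the processes themselves, are independent.

Measurability is in fact exact. Edges are detected by counts over countably many pairs of balls, so
distances to the graph are random variables. Being 1-Lipschitz in the base point, they reduce
erosion and opening to countable conditions. -/

theorem PointConfig.finite_inter {d : ℕ} (φ : PointConfig d) {B : Set (EuclideanSpace ℝ (Fin d))}
    (hB : Bornology.IsBounded B) : (φ.carrier ∩ B).Finite :=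
  (φ.locallyFinite _ hB.isCompact_closure).subset (inter_subset_inter_right _ subset_closure)

theorem PointConfig.measurable_count {d : ℕ} {B : Set (EuclideanSpace ℝ (Fin d))}
    (hB : MeasurableSet B) (hb : Bornology.IsBounded B) :
    Measurable (fun φ : PointConfig d => φ.count B) :=
  Measurable.of_comap_le (le_iSup (fun B : {B : Set (EuclideanSpace ℝ (Fin d)) //
    MeasurableSet B ∧ Bornology.IsBounded B} =>
      MeasurableSpace.comap (fun φ : PointConfig d => φ.count B.1) ⊤) ⟨B, hB, hb⟩)

theorem PointConfig.measurableSet_count_eq {d : ℕ} {B : Set (EuclideanSpace ℝ (Fin d))}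
    (hB : MeasurableSet B) (hb : Bornology.IsBounded B) (n : ℕ) :
    MeasurableSet {φ : PointConfig d | φ.count B = n} :=
  PointConfig.measurable_count hB hb (measurableSet_singleton n)

theorem PointConfig.count_eq_zero {d : ℕ} (φ : PointConfig d)
    {B : Set (EuclideanSpace ℝ (Fin d))} (hB : Bornology.IsBounded B) :
    φ.count B = 0 ↔ ∀ x ∈ φ.carrier, x ∉ B := by
  rw [PointConfig.count, Set.ncard_eq_zero (φ.finite_inter hB), Set.eq_empty_iff_forall_notMem]
  simp

theorem PointConfig.count_eq_one {d : ℕ} (φ : PointConfig d)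
    {B : Set (EuclideanSpace ℝ (Fin d))} :
    φ.count B = 1 ↔ ∃ a ∈ φ.carrier, a ∈ B ∧ ∀ x ∈ φ.carrier, x ∈ B → x = a := by
  rw [PointConfig.count, Set.ncard_eq_one]
  constructor
  · rintro ⟨a, ha⟩
    have h : a ∈ φ.carrier ∩ B := ha ▸ mem_singleton a
    exact ⟨a, h.1, h.2, fun x hx hxB => by
      have : x ∈ φ.carrier ∩ B := ⟨hx, hxB⟩
      rwa [ha] at this⟩
  · rintro ⟨a, ha, haB, h⟩
    refine ⟨a, Set.ext fun x => ⟨fun hx => h x hx.1 hx.2, ?_⟩⟩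
    rintro rfl
    exact ⟨ha, haB⟩

theorem PointConfig.measurableSet_exists_mem {d : ℕ} {B : Set (EuclideanSpace ℝ (Fin d))}
    (hB : MeasurableSet B) : MeasurableSet {φ : PointConfig d | ∃ a ∈ φ.carrier, a ∈ B} := by
  have h : {φ : PointConfig d | ∃ a ∈ φ.carrier, a ∈ B} =
      ⋃ n : ℕ, {φ : PointConfig d | φ.count (B ∩ Metric.closedBall 0 n) = 0}ᶜ := by
    ext φ
    simp only [mem_ofPred_eq, mem_iUnion, mem_compl_iff]
    constructor
    · rintro ⟨a, ha, haB⟩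
      obtain ⟨n, hn⟩ := exists_nat_ge ‖a‖
      refine ⟨n, fun h => ?_⟩
      rw [φ.count_eq_zero (Metric.isBounded_closedBall.subset inter_subset_right)] at h
      exact h a ha ⟨haB, by simpa using hn⟩
    · rintro ⟨n, h⟩
      rw [φ.count_eq_zero (Metric.isBounded_closedBall.subset inter_subset_right)] at h
      push Not at h
      obtain ⟨a, ha, haB⟩ := h
      exact ⟨a, ha, haB.1⟩
  rw [h]
  exact MeasurableSet.iUnion fun n => (PointConfig.measurableSet_count_eq
    (hB.inter measurableSet_closedBall)
    (Metric.isBounded_closedBall.subset inter_subset_right) 0).compl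

/-! ### Edges of the relative neighborhood graph -/

/-- The points `a` and `b` are the end points of an edge of the relative neighborhood graph. -/
def IsRelNbhdEdge {d : ℕ} (φ : Set (EuclideanSpace ℝ (Fin d)))
    (a b : EuclideanSpace ℝ (Fin d)) : Prop :=
  a ∈ φ ∧ b ∈ φ ∧ a ≠ b ∧ ∀ z ∈ φ, z ≠ a → z ≠ b → dist a b < max (dist a z) (dist b z)

theorem mem_relNbhdSet {d : ℕ} {φ : Set (EuclideanSpace ℝ (Fin d))}
    {x : EuclideanSpace ℝ (Fin d)} :
    x ∈ relNbhdSet φ ↔ x ∈ φ ∨ ∃ a b, IsRelNbhdEdge φ a b ∧ x ∈ segment ℝ a b := by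
  simp only [relNbhdSet, mem_union, mem_iUnion, relNbhdGraph, IsRelNbhdEdge]
  refine or_congr Iff.rfl ⟨?_, ?_⟩
  · rintro ⟨a, b, ⟨hne, h⟩, hx⟩
    refine ⟨a, b, ⟨a.2, b.2, fun h => hne (Subtype.ext h), fun z hz hza hzb => ?_⟩, hx⟩
    by_contra hcon
    exact h ⟨⟨z, hz⟩, fun h => hza (congrArg Subtype.val h), fun h => hzb (congrArg Subtype.val h),
      not_lt.1 hcon⟩
  · rintro ⟨a, b, ⟨ha, hb, hne, h⟩, hx⟩
    refine ⟨⟨a, ha⟩, ⟨b, hb⟩, ⟨fun h => hne (congrArg Subtype.val h), ?_⟩, hx⟩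
    rintro ⟨z, hza, hzb, hz⟩
    exact absurd (h z z.2 (fun h => hza (Subtype.ext h)) (fun h => hzb (Subtype.ext h)))
      (not_lt.2 hz)

theorem infEDist_relNbhdSet_lt {d : ℕ} {φ : Set (EuclideanSpace ℝ (Fin d))}
    {x : EuclideanSpace ℝ (Fin d)} {r : ℝ≥0∞} :
    Metric.infEDist x (relNbhdSet φ) < r ↔ (∃ a ∈ φ, edist x a < r) ∨
      ∃ a b, IsRelNbhdEdge φ a b ∧ Metric.infEDist x (segment ℝ a b) < r := by
  simp only [Metric.infEDist_lt_iff, mem_relNbhdSet]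
  constructor
  · rintro ⟨y, hy | ⟨a, b, hab, hy⟩, hxy⟩
    · exact Or.inl ⟨y, hy, hxy⟩
    · exact Or.inr ⟨a, b, hab, y, hy, hxy⟩
  · rintro (⟨y, hy, hxy⟩ | ⟨a, b, hab, y, hy, hxy⟩)
    · exact ⟨y, Or.inl hy, hxy⟩
    · exact ⟨y, Or.inr ⟨a, b, hab, hy⟩, hxy⟩

theorem infEDist_segment_le {d : ℕ} {a b p q : EuclideanSpace ℝ (Fin d)} {s : ℝ}
    (ha : dist a p ≤ s) (hb : dist b q ≤ s) (x : EuclideanSpace ℝ (Fin d)) :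
    Metric.infEDist x (segment ℝ a b) ≤ Metric.infEDist x (segment ℝ p q) + ENNReal.ofReal s := by
  have key : ∀ a b p q : EuclideanSpace ℝ (Fin d), dist a p ≤ s → dist b q ≤ s →
      ∀ y ∈ segment ℝ p q, ∃ z ∈ segment ℝ a b, edist y z ≤ ENNReal.ofReal s := by
    rintro a b p q ha hb _ ⟨t, u, ht, hu, htu, rfl⟩
    refine ⟨t • a + u • b, ⟨t, u, ht, hu, htu, rfl⟩, ?_⟩
    rw [edist_dist]
    refine ENNReal.ofReal_le_ofReal ?_
    calc dist (t • p + u • q) (t • a + u • b) ≤ dist (t • p) (t • a) + dist (u • q) (u • b) :=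
          dist_add_add_le _ _ _ _
      _ = t * dist a p + u * dist b q := by
          rw [dist_smul₀, dist_smul₀, Real.norm_of_nonneg ht, Real.norm_of_nonneg hu,
            dist_comm p, dist_comm q]
      _ ≤ t * s + u * s := by gcongr
      _ = s := by rw [← add_mul, htu, one_mul]
  refine (Metric.infEDist_le_infEDist_add_hausdorffEDist (s := segment ℝ p q)).trans ?_
  gcongr
  refine Metric.hausdorffEDist_le_of_mem_edist (key a b p q ha hb) (key p q a b ?_ ?_)
  · rwa [dist_comm]
  · rwa [dist_comm]

/-- The closed lune of `p` and `q`, enlarged by `t`. -/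
def enlargedLune {d : ℕ} (p q : EuclideanSpace ℝ (Fin d)) (t : ℝ) :
    Set (EuclideanSpace ℝ (Fin d)) :=
  {z | max (dist p z) (dist q z) ≤ dist p q + t}

theorem mem_enlargedLune {d : ℕ} {p q z : EuclideanSpace ℝ (Fin d)} {t : ℝ} :
    z ∈ enlargedLune p q t ↔ max (dist p z) (dist q z) ≤ dist p q + t :=
  Iff.rfl

theorem isBounded_enlargedLune {d : ℕ} (p q : EuclideanSpace ℝ (Fin d)) (t : ℝ) :
    Bornology.IsBounded (enlargedLune p q t) :=
  (Metric.isBounded_closedBall (x := p) (r := dist p q + t)).subset fun z hz => by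
    rw [Metric.mem_closedBall, dist_comm]
    exact (le_max_left _ _).trans (mem_enlargedLune.1 hz)

theorem measurableSet_enlargedLune {d : ℕ} (p q : EuclideanSpace ℝ (Fin d)) (t : ℝ) :
    MeasurableSet (enlargedLune p q t) :=
  (isClosed_le (by fun_prop) continuous_const).measurableSet

/-- The balls of radius `s` around `p` and `q` hold one point each, and there are no further points in
the enlarged lune. If the balls are disjoint, these two points are the end points of an edge. -/
def IsolatesEdge {d : ℕ} (φ : PointConfig d) (p q : EuclideanSpace ℝ (Fin d)) (s : ℝ) : Prop :=
  φ.count (Metric.ball p s) = 1 ∧ φ.count (Metric.ball q s) = 1 ∧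
    φ.count (enlargedLune p q (3 * s) \ (Metric.ball p s ∪ Metric.ball q s)) = 0

theorem measurableSet_isolatesEdge {d : ℕ} (p q : EuclideanSpace ℝ (Fin d)) (s : ℝ) :
    MeasurableSet {φ : PointConfig d | IsolatesEdge φ p q s} :=
  (PointConfig.measurableSet_count_eq measurableSet_ball Metric.isBounded_ball 1).inter
    ((PointConfig.measurableSet_count_eq measurableSet_ball Metric.isBounded_ball 1).inter
      (PointConfig.measurableSet_count_eq ((measurableSet_enlargedLune p q _).diff
        (measurableSet_ball.union measurableSet_ball))
        ((isBounded_enlargedLune p q _).subset sdiff_subset) 0))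

/-- The margin `3 * s` of the lune pays for moving the end points: `dist a b` exceeds `dist p q` by
at most `2 * s`, and measuring from `p` instead of `a` costs another `s`. -/
theorem IsolatesEdge.exists_edge {d : ℕ} {φ : PointConfig d} {p q : EuclideanSpace ℝ (Fin d)}
    {s : ℝ} (h : IsolatesEdge φ p q s) (hpq : 2 * s ≤ dist p q) :
    ∃ a b, IsRelNbhdEdge φ.carrier a b ∧ dist a p < s ∧ dist b q < s := by
  obtain ⟨h1, h2, h3⟩ := h
  obtain ⟨a, ha, hap, ha'⟩ := φ.count_eq_one.1 h1
  obtain ⟨b, hb, hbq, hb'⟩ := φ.count_eq_one.1 h2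
  rw [φ.count_eq_zero ((isBounded_enlargedLune p q _).subset sdiff_subset)] at h3
  rw [Metric.mem_ball] at hap hbq
  refine ⟨a, b, ⟨ha, hb, ?_, fun z hz hza hzb => ?_⟩, hap, hbq⟩
  · rintro rfl
    have := dist_triangle_left p q a
    linarith
  · by_contra hcon
    refine h3 z hz ⟨?_, ?_⟩
    · obtain ⟨h4, h4'⟩ := max_le_iff.1 (not_lt.1 hcon)
      have h5 := dist_triangle4_right a b p q
      have h6 := dist_triangle_left p z a
      have h7 := dist_triangle_left q z b
      exact mem_enlargedLune.2 (max_le (by linarith) (by linarith))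
    · rintro (hzp | hzq)
      · exact hza (ha' z hz hzp)
      · exact hzb (hb' z hz hzq)

/-- The blocking inequality is strict and only finitely many nodes matter, so a gap of `6 * s`
survives for small `s`: `3 * s` from the enlarged lune, `2 * s` from `dist p q` against `dist a b`,
and `s` from `p` against `a`. -/
theorem IsRelNbhdEdge.eventually_isolatesEdge {d : ℕ} {φ : PointConfig d}
    {a b : EuclideanSpace ℝ (Fin d)} (h : IsRelNbhdEdge φ.carrier a b) :
    ∀ᶠ s in nhdsWithin (0 : ℝ) (Ioi 0), ∀ p q, dist a p < s → dist b q < s →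
      2 * s ≤ dist p q ∧ IsolatesEdge φ p q s := by
  obtain ⟨ha, hb, hab, hz⟩ := h
  have hfin : (φ.carrier ∩ Metric.closedBall a (dist a b + 6)).Finite :=
    φ.finite_inter Metric.isBounded_closedBall
  have hd : 0 < dist a b := dist_pos.2 hab
  have e1 : ∀ᶠ s in nhdsWithin (0 : ℝ) (Ioi 0), s < 1 :=
    nhdsWithin_le_nhds (gt_mem_nhds one_pos)
  have e2 : ∀ᶠ s in nhdsWithin (0 : ℝ) (Ioi 0), s < dist a b / 4 :=
    nhdsWithin_le_nhds (gt_mem_nhds (by linarith))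
  have e3 : ∀ᶠ s in nhdsWithin (0 : ℝ) (Ioi 0),
      ∀ z ∈ φ.carrier ∩ Metric.closedBall a (dist a b + 6), z ≠ a → z ≠ b →
        dist a b + 6 * s < max (dist a z) (dist b z) := by
    rw [Filter.eventually_all_finite hfin]
    intro z hz'
    by_cases hza : z = a
    · simp [hza]
    by_cases hzb : z = b
    · simp [hzb]
    have := hz z hz'.1 hza hzb
    have e : ∀ᶠ s in nhdsWithin (0 : ℝ) (Ioi 0),
        s < (max (dist a z) (dist b z) - dist a b) / 6 :=
      nhdsWithin_le_nhds (gt_mem_nhds (by linarith))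
    filter_upwards [e] with s hs _ _
    linarith
  have e4 : ∀ᶠ s in nhdsWithin (0 : ℝ) (Ioi 0), 0 < s := self_mem_nhdsWithin
  filter_upwards [e1, e2, e3, e4] with s h1 h2 h3 h4 p q hp hq
  -- a point near `a` or `b` lies in the enlarged lune
  have key : ∀ z ∈ φ.carrier, dist a z ≤ dist a b + 6 * s → dist b z ≤ dist a b + 6 * s →
      z = a ∨ z = b := by
    intro z hz hza hzb
    by_contra! hcon
    have := h3 z ⟨hz, by rw [Metric.mem_closedBall, dist_comm]; linarith⟩ hcon.1 hcon.2
    exact absurd this (not_lt.2 (max_le hza hzb))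
  have t1 := dist_triangle4_right a b p q
  have t2 := dist_triangle4 p a b q
  rw [dist_comm p a] at t2
  refine ⟨by linarith, ?_, ?_, ?_⟩
  · refine φ.count_eq_one.2 ⟨a, ha, hp, fun z hz hzp => ?_⟩
    rw [Metric.mem_ball, dist_comm] at hzp
    have t3 := dist_triangle a p z
    have t4 := dist_triangle_left b z a
    rcases key z hz (by linarith) (by linarith) with h | rfl
    · exact h
    · linarith
  · refine φ.count_eq_one.2 ⟨b, hb, hq, fun z hz hzp => ?_⟩
    rw [Metric.mem_ball, dist_comm] at hzp
    have t3 := dist_triangle b q z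
    have t4 := dist_triangle a b z
    have t5 := dist_comm a b
    rcases key z hz (by linarith) (by linarith) with rfl | h
    · linarith
    · exact h
  · rw [φ.count_eq_zero ((isBounded_enlargedLune p q _).subset sdiff_subset)]
    rintro z hz ⟨hzl, hzpq⟩
    obtain ⟨l1, l2⟩ := max_le_iff.1 (mem_enlargedLune.1 hzl)
    have t3 := dist_triangle a p z
    have t4 := dist_triangle b q z
    rcases key z hz (by linarith) (by linarith) with rfl | rfl
    · exact hzpq (Or.inl hp)
    · exact hzpq (Or.inr hq)

theorem measurable_infEDist_relNbhdSet {d : ℕ} (x : EuclideanSpace ℝ (Fin d)) :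
    Measurable (fun φ : PointConfig d => Metric.infEDist x (relNbhdSet φ.carrier)) := by
  refine measurable_of_Iio fun r => ?_
  set D := TopologicalSpace.denseSeq (EuclideanSpace ℝ (Fin d)) with hD
  let s : ℕ → ℝ := fun n => 1 / ((n : ℝ) + 1)
  have hs0 : ∀ n, 0 < s n := fun n => Nat.one_div_pos_of_nat
  have hs : Filter.Tendsto s Filter.atTop (nhdsWithin 0 (Ioi 0)) :=
    tendsto_nhdsWithin_iff.2 ⟨tendsto_one_div_add_atTop_nhds_zero_nat,
      Filter.Eventually.of_forall hs0⟩
  have h : (fun φ : PointConfig d => Metric.infEDist x (relNbhdSet φ.carrier)) ⁻¹' Iio r =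
      {φ : PointConfig d | ∃ a ∈ φ.carrier, a ∈ Metric.eball x r} ∪
        ⋃ (i : ℕ) (j : ℕ) (n : ℕ), {φ : PointConfig d |
          (2 * s n ≤ dist (D i) (D j) ∧
            Metric.infEDist x (segment ℝ (D i) (D j)) + ENNReal.ofReal (s n) < r) ∧
          IsolatesEdge φ (D i) (D j) (s n)} := by
    ext φ
    simp only [mem_preimage, mem_Iio, infEDist_relNbhdSet_lt, mem_union, mem_iUnion,
      mem_ofPred_eq, Metric.mem_eball]
    refine or_congr ⟨?_, ?_⟩ ⟨?_, ?_⟩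
    · rintro ⟨a, ha, har⟩
      exact ⟨a, ha, by rwa [edist_comm]⟩
    · rintro ⟨a, ha, har⟩
      exact ⟨a, ha, by rwa [edist_comm]⟩
    · rintro ⟨a, b, hab, hr⟩
      -- The slack `ρ` is spent in two halves: one for replacing the edge by a segment with dense
      -- end points, one for the tolerance `s n` in the event.
      obtain ⟨ρ, hρ, hρr⟩ := ENNReal.lt_iff_exists_add_pos_lt.1 hr
      have hρ' : (0 : ℝ) < ρ / 2 := by positivity
      have e : ∀ᶠ t : ℝ in nhdsWithin (0 : ℝ) (Ioi 0), t < ρ / 2 :=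
        nhdsWithin_le_nhds (gt_mem_nhds hρ')
      obtain ⟨n, hn, hnρ⟩ := (hs.eventually (hab.eventually_isolatesEdge.and e)).exists
      obtain ⟨i, hi⟩ := (TopologicalSpace.denseRange_denseSeq _).exists_dist_lt a (hs0 n)
      obtain ⟨j, hj⟩ := (TopologicalSpace.denseRange_denseSeq _).exists_dist_lt b (hs0 n)
      obtain ⟨h1, h2⟩ := hn _ _ hi hj
      refine ⟨i, j, n, ⟨h1, lt_of_le_of_lt ?_ hρr⟩, h2⟩
      rw [dist_comm] at hi hj
      calc Metric.infEDist x (segment ℝ (D i) (D j)) + ENNReal.ofReal (s n)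
          ≤ Metric.infEDist x (segment ℝ a b) + ENNReal.ofReal (s n) + ENNReal.ofReal (s n) := by
            gcongr
            exact infEDist_segment_le hi.le hj.le x
        _ ≤ Metric.infEDist x (segment ℝ a b) + ρ := by
            rw [add_assoc, ← ENNReal.ofReal_add (hs0 n).le (hs0 n).le]
            gcongr
            exact ENNReal.ofReal_le_of_le_toReal (by simp; linarith)
    · rintro ⟨i, j, n, ⟨h1, h2⟩, h3⟩
      obtain ⟨a, b, hab, ha, hb⟩ := h3.exists_edge h1
      exact ⟨a, b, hab, (infEDist_segment_le ha.le hb.le x).trans_lt h2⟩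
  rw [h]
  refine (PointConfig.measurableSet_exists_mem Metric.isOpen_eball.measurableSet).union ?_
  exact MeasurableSet.iUnion fun i => MeasurableSet.iUnion fun j => MeasurableSet.iUnion fun n =>
    (MeasurableSet.const _).inter (measurableSet_isolatesEdge _ _ _)

/-! ### Measurability of erosions and openings of random closed sets -/

theorem closedBall_subset_iff_of_denseRange {E : Type*} [NormedAddCommGroup E] [NormedSpace ℝ E]
    {ι : Type*} {D : ι → E} (hD : DenseRange D) {S : Set E} (hS : IsClosed S) {r : ℝ} (hr : 0 < r)
    (y : E) : Metric.closedBall y r ⊆ S ↔ ∀ i, D i ∈ Metric.ball y r → D i ∈ S := by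
  constructor
  · exact fun h i hi => h (Metric.ball_subset_closedBall hi)
  · intro h
    rw [← closure_ball y hr.ne']
    refine closure_minimal ?_ hS
    refine (hD.open_subset_closure_inter Metric.isOpen_ball).trans (closure_minimal ?_ hS)
    rintro _ ⟨hx, i, rfl⟩
    exact h i hx

theorem mem_opening_zero_iff {d : ℕ} {r : ℝ} {A : Set (EuclideanSpace ℝ (Fin d))} :
    0 ∈ opening r A ↔ ∃ y, ‖y‖ ≤ r ∧ Metric.closedBall y r ⊆ A := by
  simp only [opening, erosion, Set.mem_add, mem_ofPred_eq, mem_closedBall_zero_iff]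
  constructor
  · rintro ⟨y, hy, z, hz, h⟩
    rw [add_eq_zero_iff_eq_neg] at h
    exact ⟨y, by rwa [h, norm_neg], hy⟩
  · rintro ⟨y, hy, h⟩
    exact ⟨y, h, -y, by rwa [norm_neg], add_neg_cancel y⟩

section RandomSets

variable {Ω : Type*} [MeasurableSpace Ω] {d : ℕ}
  {f g : Ω → EuclideanSpace ℝ (Fin d) → ℝ≥0∞}

theorem continuous_of_le_edist_add {E : Type*} [PseudoEMetricSpace E] {f : E → ℝ≥0∞}
    (hf : ∀ x y, f x ≤ f y + edist x y) : Continuous f :=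
  continuous_of_le_add_edist 1 (by simp) (by simpa using hf)

theorem measurableSet_closedBall_subset_le (hf : ∀ x, Measurable fun ω => f ω x)
    (hg : ∀ x, Measurable fun ω => g ω x) (hfc : ∀ ω, Continuous (f ω))
    (hgc : ∀ ω, Continuous (g ω)) {r : ℝ} (hr : 0 < r) (y : EuclideanSpace ℝ (Fin d)) (e : ℝ≥0∞) :
    MeasurableSet {ω | Metric.closedBall y r ⊆ {x | f ω x ≤ g ω x + e}} := by
  have hcl : ∀ ω, IsClosed {x | f ω x ≤ g ω x + e} := fun ω =>
    isClosed_le (hfc ω) ((hgc ω).add continuous_const)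
  simp_rw [closedBall_subset_iff_of_denseRange
    (TopologicalSpace.denseRange_denseSeq (EuclideanSpace ℝ (Fin d))) (hcl _) hr]
  rw [ofPred_forall]
  refine MeasurableSet.iInter fun i => ?_
  by_cases hi : TopologicalSpace.denseSeq (EuclideanSpace ℝ (Fin d)) i ∈ Metric.ball y r
  · simp only [hi, true_imp_iff]
    exact measurableSet_le (hf _) ((hg _).add measurable_const)
  · simp [hi]

/-- This removes the uncountable choice of a centre. Moving a ball by `s` changes `f` and `g` by at
most `s` each, hence the tolerance `2 * s`. Conversely, approximate centres lie in a compact ball,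
and a limit of a subsequence is an exact centre. -/
theorem exists_closedBall_subset_le_iff {f g : EuclideanSpace ℝ (Fin d) → ℝ≥0∞}
    (hf : ∀ x y, f x ≤ f y + edist x y) (hg : ∀ x y, g x ≤ g y + edist x y) {r : ℝ} (hr : 0 < r) :
    (∃ y, ‖y‖ ≤ r ∧ Metric.closedBall y r ⊆ {x | f x ≤ g x}) ↔
      ∀ n : ℕ, ∃ i : ℕ, ‖TopologicalSpace.denseSeq (EuclideanSpace ℝ (Fin d)) i‖
          ≤ r + 1 / ((n : ℝ) + 1) ∧
        Metric.closedBall (TopologicalSpace.denseSeq (EuclideanSpace ℝ (Fin d)) i) r ⊆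
          {x | f x ≤ g x + ENNReal.ofReal (2 * (1 / ((n : ℝ) + 1)))} := by
  set D := TopologicalSpace.denseSeq (EuclideanSpace ℝ (Fin d)) with hD
  constructor
  · rintro ⟨y, hy, h⟩ n
    have hs : 0 < 1 / ((n : ℝ) + 1) := Nat.one_div_pos_of_nat
    set s := 1 / ((n : ℝ) + 1)
    obtain ⟨i, hi⟩ := (TopologicalSpace.denseRange_denseSeq _).exists_dist_lt y hs
    refine ⟨i, ?_, fun x hx => ?_⟩
    · have := norm_le_norm_add_norm_sub' (D i) y
      rw [← dist_eq_norm, dist_comm] at this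
      linarith
    · have hx' : x + (y - D i) ∈ Metric.closedBall y r := by
        rw [Metric.mem_closedBall, dist_eq_norm] at hx ⊢
        convert hx using 2
        abel
      have he : edist x (x + (y - D i)) ≤ ENNReal.ofReal s := by
        rw [edist_dist, dist_self_add_right, ← dist_eq_norm]
        exact ENNReal.ofReal_le_ofReal hi.le
      have h1 : f (x + (y - D i)) ≤ g (x + (y - D i)) := h hx'
      show f x ≤ g x + ENNReal.ofReal (2 * s)
      calc f x ≤ f (x + (y - D i)) + edist x (x + (y - D i)) := hf _ _
        _ ≤ g (x + (y - D i)) + edist x (x + (y - D i)) := by gcongr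
        _ ≤ g x + edist (x + (y - D i)) x + edist x (x + (y - D i)) := by gcongr; exact hg _ _
        _ ≤ g x + ENNReal.ofReal s + ENNReal.ofReal s := by
          gcongr
          rwa [edist_comm]
        _ = g x + ENNReal.ofReal (2 * s) := by
          rw [two_mul, ENNReal.ofReal_add hs.le hs.le, add_assoc]
  · intro h
    choose i hi h using h
    have hs : Filter.Tendsto (fun n : ℕ => 1 / ((n : ℝ) + 1)) Filter.atTop (nhds 0) :=
      tendsto_one_div_add_atTop_nhds_zero_nat
    obtain ⟨y, -, φ, hφ, hy⟩ := (isCompact_closedBall (0 : EuclideanSpace ℝ (Fin d))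
      (r + 1)).tendsto_subseq (x := fun n => D (i n)) fun n => by
        rw [mem_closedBall_zero_iff]
        refine (hi n).trans ?_
        gcongr
        rw [div_le_one (by positivity)]
        linarith [(n.cast_nonneg : (0 : ℝ) ≤ n)]
    have hs' := hs.comp hφ.tendsto_atTop
    refine ⟨y, ?_, ?_⟩
    · refine le_of_tendsto_of_tendsto' hy.norm ?_ fun n => hi (φ n)
      simpa using hs'.const_add r
    · have hcl : IsClosed {x | f x ≤ g x} :=
        isClosed_le (continuous_of_le_edist_add hf) (continuous_of_le_edist_add hg)
      rw [← closure_ball y hr.ne']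
      -- Points of the open ball around the limit eventually lie in the approximating balls;
      -- boundary points follow by closedness.
      refine closure_minimal (fun x hx => ?_) hcl
      have hlim : Filter.Tendsto
          (fun n => g x + ENNReal.ofReal (2 * (1 / ((φ n : ℝ) + 1)))) Filter.atTop
          (nhds (g x)) := by
        have := (ENNReal.tendsto_ofReal (hs'.const_mul 2)).const_add (g x)
        simpa using this
      refine ge_of_tendsto hlim ?_
      have hx' : ∀ᶠ n in Filter.atTop, dist x (D (i (φ n))) < r :=
        (tendsto_const_nhds.dist hy).eventually (gt_mem_nhds hx)
      filter_upwards [hx'] with n hn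
      exact h (φ n) (Metric.mem_closedBall.2 hn.le)

theorem measurableSet_zero_mem_erosion (hf : ∀ x, Measurable fun ω => f ω x)
    (hg : ∀ x, Measurable fun ω => g ω x) (hfc : ∀ ω x y, f ω x ≤ f ω y + edist x y)
    (hgc : ∀ ω x y, g ω x ≤ g ω y + edist x y) {r : ℝ} (hr : 0 < r) :
    MeasurableSet {ω | 0 ∈ erosion r {x | f ω x ≤ g ω x}} := by
  simpa [erosion] using measurableSet_closedBall_subset_le hf hg
    (fun ω => continuous_of_le_edist_add (hfc ω)) (fun ω => continuous_of_le_edist_add (hgc ω))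
    hr 0 0

theorem measurableSet_zero_mem_opening (hf : ∀ x, Measurable fun ω => f ω x)
    (hg : ∀ x, Measurable fun ω => g ω x) (hfc : ∀ ω x y, f ω x ≤ f ω y + edist x y)
    (hgc : ∀ ω x y, g ω x ≤ g ω y + edist x y) {r : ℝ} (hr : 0 < r) :
    MeasurableSet {ω | 0 ∈ opening r {x | f ω x ≤ g ω x}} := by
  simp_rw [mem_opening_zero_iff, exists_closedBall_subset_le_iff (hfc _) (hgc _) hr]
  simp only [ofPred_forall, ofPred_exists]
  exact MeasurableSet.iInter fun n => MeasurableSet.iUnion fun i =>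
    (MeasurableSet.const _).inter (measurableSet_closedBall_subset_le hf hg
      (fun ω => continuous_of_le_edist_add (hfc ω)) (fun ω => continuous_of_le_edist_add (hgc ω))
      hr _ _)

end RandomSets

theorem measurableSet_zero_mem_erosion_diff_opening {Ω ι : Type*} [MeasurableSpace Ω] [Finite ι]
    {d : ℕ} {X : ι → Ω → PointConfig d} (hX : ∀ i, Measurable (X i)) (i : ι) {r₁ r₂ : ℝ}
    (hr₁ : 0 < r₁) (hr₂ : 0 < r₂) :
    MeasurableSet {ω | 0 ∈ erosion r₁ (voronoiMollification i fun j => (X j ω).carrier) \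
      opening r₂ (voronoiMollification i fun j => (X j ω).carrier)} := by
  have hm : ∀ j x, Measurable fun ω => Metric.infEDist x (relNbhdSet (X j ω).carrier) :=
    fun j x => (measurable_infEDist_relNbhdSet x).comp (hX j)
  have hL : ∀ j ω x y, Metric.infEDist x (relNbhdSet (X j ω).carrier) ≤
      Metric.infEDist y (relNbhdSet (X j ω).carrier) + edist x y := fun _ _ _ _ =>
    Metric.infEDist_le_infEDist_add_edist
  have hm' : ∀ x, Measurable fun ω => ⨅ j, Metric.infEDist x (relNbhdSet (X j ω).carrier) :=
    fun x => Measurable.iInf fun j => hm j x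
  have hL' : ∀ ω x y, ⨅ j, Metric.infEDist x (relNbhdSet (X j ω).carrier) ≤
      (⨅ j, Metric.infEDist y (relNbhdSet (X j ω).carrier)) + edist x y := fun ω x y => by
    rw [ENNReal.iInf_add]
    exact iInf_mono fun j => hL j ω x y
  exact (measurableSet_zero_mem_erosion (hm i) hm' (hL i) hL' hr₁).diff
    (measurableSet_zero_mem_opening (hm i) hm' (hL i) hL' hr₂)

/-! ### Poisson processes with prescribed positions of their points -/

theorem poissonMeasure_singleton_zero_pos (r : ℝ≥0) : 0 < poissonMeasure r {0} := by
  rw [poissonMeasure_singleton]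
  simp only [pow_zero, Nat.factorial_zero, Nat.cast_one, mul_one, div_one]
  exact ENNReal.ofReal_pos.2 (Real.exp_pos _)

theorem poissonMeasure_singleton_pos {r : ℝ≥0} (hr : 0 < r) (n : ℕ) :
    0 < poissonMeasure r {n} := by
  have hr' : (0 : ℝ) < r := hr
  rw [poissonMeasure_singleton]
  exact ENNReal.ofReal_pos.2 (by positivity)

/-- A null set may still be required to be empty: the parameter of the Poisson law is then `0`, and
its mass at `0` is positive. -/
theorem IsPoissonProcess.measure_forall_count_eq_pos {Ω : Type*} [MeasurableSpace Ω] {d : ℕ}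
    {P : Measure Ω} {lam : ℝ≥0} {X : Ω → PointConfig d} (hX : IsPoissonProcess P lam X)
    (hlam : 0 < lam) {ι : Type*} [Finite ι] {B : ι → Set (EuclideanSpace ℝ (Fin d))}
    (hB : ∀ i, MeasurableSet (B i)) (hb : ∀ i, Bornology.IsBounded (B i))
    (hd : Pairwise fun i j => Disjoint (B i) (B j)) (n : ι → ℕ)
    (hn : ∀ i, n i = 0 ∨ 0 < volume (B i)) :
    0 < P {ω | ∀ i, (X ω).count (B i) = n i} := by
  obtain ⟨m, ⟨e⟩⟩ := Finite.exists_equiv_fin ι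
  have hind := hX.iIndepFun_count m (fun i => B (e.symm i)) (fun i => hB _) (fun i => hb _)
    fun i j hij => hd (e.symm.injective.ne hij)
  have hset : {ω | ∀ i, (X ω).count (B i) = n i} =
      ⋂ i ∈ (Finset.univ : Finset (Fin m)),
        (fun ω => (X ω).count (B (e.symm i))) ⁻¹' {n (e.symm i)} := by
    ext ω
    simp [e.symm.forall_congr_left]
  rw [hset, hind.measure_inter_preimage_eq_mul _ fun i _ => measurableSet_singleton _,
    pos_iff_ne_zero, Finset.prod_ne_zero_iff]
  intro i _
  have hlaw := (hX.hasLaw_count _ (hB (e.symm i)) (hb _)).measure_eq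
    (p := fun k => k = n (e.symm i)) (measurableSet_singleton _)
  have heq : (fun ω => (X ω).count (B (e.symm i))) ⁻¹' {n (e.symm i)} =
      {ω | (X ω).count (B (e.symm i)) = n (e.symm i)} := rfl
  rw [heq, hlaw, ← pos_iff_ne_zero]
  rcases hn (e.symm i) with h | h
  · rw [h]
    exact poissonMeasure_singleton_zero_pos _
  · refine poissonMeasure_singleton_pos (mul_pos hlam ?_) _
    exact ENNReal.toNNReal_pos h.ne' (hb _).measure_lt_top.ne

/-- The points of `φ` in the closed ball of radius `R` around the origin are all within distance
`ε` of `F`, and every point of `F` has a point of `φ` within distance `ε`. -/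
def IsNearIn {d : ℕ} (F : Set (EuclideanSpace ℝ (Fin d))) (ε R : ℝ) (φ : PointConfig d) : Prop :=
  (∀ p ∈ F, ∃ a ∈ φ.carrier, dist a p < ε) ∧
    ∀ a ∈ φ.carrier, ‖a‖ ≤ R → ∃ p ∈ F, dist a p < ε

theorem exists_separation_of_finite {E : Type*} [MetricSpace E] {F : Set E} (hF : F.Finite)
    {ε : ℝ} (hε : 0 < ε) :
    ∃ δ, 0 < δ ∧ δ ≤ ε ∧ ∀ p ∈ F, ∀ q ∈ F, p ≠ q → δ + δ ≤ dist p q := by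
  have h1 : ∀ᶠ δ in nhdsWithin (0 : ℝ) (Ioi 0), ∀ p ∈ F, ∀ q ∈ F, p ≠ q → δ + δ ≤ dist p q := by
    rw [Filter.eventually_all_finite hF]
    intro p _
    rw [Filter.eventually_all_finite hF]
    intro q _
    by_cases hpq : p = q
    · simp [hpq]
    have : ∀ᶠ δ in nhdsWithin (0 : ℝ) (Ioi 0), δ < dist p q / 2 :=
      nhdsWithin_le_nhds (gt_mem_nhds (half_pos (dist_pos.2 hpq)))
    filter_upwards [this] with δ hδ _
    linarith
  have h2 : ∀ᶠ δ in nhdsWithin (0 : ℝ) (Ioi 0), δ < ε := nhdsWithin_le_nhds (gt_mem_nhds hε)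
  have h3 : ∀ᶠ δ in nhdsWithin (0 : ℝ) (Ioi 0), 0 < δ := self_mem_nhdsWithin
  obtain ⟨δ, h1, h2, h3⟩ := (h1.and (h2.and h3)).exists
  exact ⟨δ, h3, h2.le, h1⟩

theorem exists_measurableSet_isNearIn {d : ℕ} {F : Set (EuclideanSpace ℝ (Fin d))}
    (hF : F.Finite) {ε : ℝ} (hε : 0 < ε) (R : ℝ) :
    ∃ A : Set (PointConfig d), MeasurableSet A ∧ (∀ φ ∈ A, IsNearIn F ε R φ) ∧
      ∀ {Ω : Type*} [MeasurableSpace Ω] {P : Measure Ω} {lam : ℝ≥0} {X : Ω → PointConfig d},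
        IsPoissonProcess P lam X → 0 < lam → 0 < P (X ⁻¹' A) := by
  obtain ⟨δ, hδ, hδε, hsep⟩ := exists_separation_of_finite hF hε
  have : Finite F := hF
  -- The index `none` is the rest of the large ball, required to be empty; each `some p` is a small
  -- ball required to hold exactly one point.
  let B : Option F → Set (EuclideanSpace ℝ (Fin d)) := fun i =>
    i.elim (Metric.closedBall 0 R \ ⋃ p : F, Metric.ball (p : EuclideanSpace ℝ (Fin d)) δ)
      fun p => Metric.ball p δ
  let n : Option F → ℕ := fun i => i.elim 0 fun _ => 1
  have hB : ∀ i, MeasurableSet (B i) := by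
    rintro (_ | p)
    · exact measurableSet_closedBall.diff (MeasurableSet.iUnion fun p => measurableSet_ball)
    · exact measurableSet_ball
  have hb : ∀ i, Bornology.IsBounded (B i) := by
    rintro (_ | p)
    · exact Metric.isBounded_closedBall.subset sdiff_subset
    · exact Metric.isBounded_ball
  have hd : Pairwise fun i j => Disjoint (B i) (B j) := by
    have h0 : ∀ p : F, Disjoint (B none) (B (some p)) := fun p =>
      disjoint_sdiff_left.mono_right (subset_iUnion (fun p : F => Metric.ball p.1 δ) p)
    rintro (_ | p) (_ | q) hpq
    · exact absurd rfl hpq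
    · exact h0 q
    · exact (h0 p).symm
    · exact Metric.ball_disjoint_ball
        (hsep p p.2 q q.2 fun h => hpq (congrArg some (Subtype.ext h)))
  refine ⟨{φ | ∀ i, φ.count (B i) = n i}, ?_, fun φ hφ => ⟨fun p hp => ?_, fun a ha haR => ?_⟩,
    fun {Ω} _ {P lam X} hX hlam => hX.measure_forall_count_eq_pos hlam hB hb hd n ?_⟩
  · rw [ofPred_forall]
    exact MeasurableSet.iInter fun i => PointConfig.measurableSet_count_eq (hB i) (hb i) _
  · obtain ⟨a, ha, hap, -⟩ := φ.count_eq_one.1 (hφ (some ⟨p, hp⟩))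
    exact ⟨a, ha, (Metric.mem_ball.1 hap).trans_le hδε⟩
  · have h := (φ.count_eq_zero (hb none)).1 (hφ none) a ha
    by_contra! hcon
    refine h ⟨by simpa using haR, ?_⟩
    simp only [mem_iUnion, Metric.mem_ball, not_exists, not_lt]
    exact fun p => hδε.trans (hcon p p.2)
  · rintro (_ | p)
    · exact Or.inl rfl
    · exact Or.inr (Metric.measure_ball_pos volume _ hδ)

/-! ### Configurations whose graph avoids a ball -/

theorem IsRelNbhdEdge.not_blocked {d : ℕ} {φ : Set (EuclideanSpace ℝ (Fin d))}
    {x y z : EuclideanSpace ℝ (Fin d)} (h : IsRelNbhdEdge φ x y) (hz : z ∈ φ)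
    (hxz : dist x z < dist x y) (hyz : dist y z < dist x y) : z = x ∨ z = y := by
  by_contra! hcon
  exact absurd (h.2.2.2 z hz hcon.1 hcon.2) (not_lt.2 (max_lt hxz hyz).le)

/-- Intended for a chord with direction `v` and midpoint `m`: leaving `m` along `n` is orthogonal to
the chord and does not decrease the norm. -/
theorem exists_norm_eq_one_inner_eq_zero {E : Type*} [NormedAddCommGroup E]
    [InnerProductSpace ℝ E] [FiniteDimensional ℝ E] (hE : 2 ≤ Module.finrank ℝ E) (v m : E) :
    ∃ n : E, ‖n‖ = 1 ∧ inner ℝ v n = 0 ∧ 0 ≤ inner ℝ m n := by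
  have h1 : Module.finrank ℝ (Submodule.span ℝ {v}) ≤ 1 := (finrank_span_le_card ({v} : Set E)).trans (by simp)
  have h2 := (Submodule.span ℝ {v}).finrank_add_finrank_orthogonal
  have h3 : 0 < Module.finrank ℝ (Submodule.span ℝ {v})ᗮ := by omega
  obtain ⟨⟨u, hu⟩, hu0⟩ := Module.finrank_pos_iff_exists_ne_zero.1 h3
  have hu0' : u ≠ 0 := fun h => hu0 (Subtype.ext h)
  have hvu : inner ℝ v u = 0 := Submodule.mem_orthogonal_singleton_iff_inner_right.1 hu
  have hn : ‖(‖u‖⁻¹ : ℝ) • u‖ = 1 := norm_smul_inv_norm hu0'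
  rcases le_total 0 (inner ℝ m ((‖u‖⁻¹ : ℝ) • u)) with h | h
  · exact ⟨_, hn, by rw [inner_smul_right, hvu, mul_zero], h⟩
  · exact ⟨-((‖u‖⁻¹ : ℝ) • u), by rw [norm_neg, hn],
      by rw [inner_neg_right, inner_smul_right, hvu, mul_zero, neg_zero],
      by rw [inner_neg_right]; linarith⟩

theorem dist_div_smul_self {E : Type*} [NormedAddCommGroup E] [NormedSpace ℝ E] {w : E}
    (hw : w ≠ 0) (R : ℝ) : dist w ((R / ‖w‖) • w) = |‖w‖ - R| := by
  have hw' : ‖w‖ ≠ 0 := norm_ne_zero_iff.2 hw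
  have : w - (R / ‖w‖) • w = ((‖w‖ - R) / ‖w‖) • w := by
    rw [sub_div, div_self hw', sub_smul, one_smul]
  rw [dist_eq_norm, this, norm_smul, norm_div, norm_norm, div_mul_cancel₀ _ hw', Real.norm_eq_abs]

/-- The lune of `x` and `y` holds a path from a point `p` of the segment to the outside of the ball
of radius `s` that stays away from the boundary of the lune. -/
theorem exists_norm_eq_dist_le {E : Type*} [NormedAddCommGroup E]
    [InnerProductSpace ℝ E] [FiniteDimensional ℝ E] (hE : 2 ≤ Module.finrank ℝ E)
    {x y p : E} {s ε : ℝ} (hs : 0 ≤ s) (hε : 0 ≤ ε) (hx : s ≤ ‖x‖) (hy : s ≤ ‖y‖)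
    (hp : p ∈ segment ℝ x y) (hps : ‖p‖ ≤ s - 9 * ε) :
    ∃ w, ‖w‖ = s ∧ dist w x ≤ dist x y - 5 * ε ∧ dist w y ≤ dist x y - 5 * ε := by
  have hpxy : dist x p + dist p y = dist x y := dist_add_dist_of_mem_segment hp
  have hpx : 9 * ε ≤ dist x p := by
    have := norm_le_norm_add_norm_sub' x p
    rw [← dist_eq_norm] at this
    linarith
  have hpy : 9 * ε ≤ dist p y := by
    have := norm_le_norm_add_norm_sub' y p
    rw [← dist_eq_norm, dist_comm] at this
    linarith
  set v : E := (1 / 2 : ℝ) • (x - y) with hv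
  set m : E := (1 / 2 : ℝ) • (x + y) with hm
  have hxm : x = m + v := by rw [hm, hv]; module
  have hym : y = m - v := by rw [hm, hv]; module
  have hvd : dist x y = 2 * ‖v‖ := by
    rw [hv, norm_smul, dist_eq_norm]
    norm_num
    ring
  obtain ⟨n, hn, hvn, hmn⟩ := exists_norm_eq_one_inner_eq_zero hE v m
  -- The point `q` has distance `√2 * ‖v‖` to both ends, less than the length `2 * ‖v‖` of the
  -- chord. Its norm is at least `s`, since `‖m‖ ^ 2 + ‖v‖ ^ 2` is the mean of `‖x‖ ^ 2` and `‖y‖ ^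
  -- 2`.
  set q : E := m + ‖v‖ • n with hq
  have hvn' : inner ℝ v (‖v‖ • n) = 0 := by rw [inner_smul_right, hvn, mul_zero]
  have hnn : ‖‖v‖ • n‖ = ‖v‖ := by rw [norm_smul, hn, mul_one, norm_norm]
  have hqx2 : dist q x ^ 2 = 2 * ‖v‖ ^ 2 := by
    have : q - x = ‖v‖ • n - v := by rw [hq, hxm]; abel
    rw [dist_eq_norm, this, norm_sub_sq_real, real_inner_comm, hvn', hnn]
    ring
  have hqy2 : dist q y ^ 2 = 2 * ‖v‖ ^ 2 := by
    have : q - y = ‖v‖ • n + v := by rw [hq, hym]; abel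
    rw [dist_eq_norm, this, norm_add_sq_real, real_inner_comm, hvn', hnn]
    ring
  have hv9 : 9 * ε ≤ ‖v‖ := by linarith
  -- The constants fit because `(2 - √2) * 9 > 5`.
  have hbound : 2 * ‖v‖ ^ 2 ≤ (2 * ‖v‖ - 5 * ε) ^ 2 := by nlinarith
  have hqx : dist q x ≤ dist x y - 5 * ε := by
    rw [hvd]
    exact le_of_sq_le_sq (hqx2.trans_le hbound) (by linarith)
  have hqy : dist q y ≤ dist x y - 5 * ε := by
    rw [hvd]
    exact le_of_sq_le_sq (hqy2.trans_le hbound) (by linarith)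
  have hqs : s ≤ ‖q‖ := by
    have h1 : ‖q‖ ^ 2 = ‖m‖ ^ 2 + 2 * inner ℝ m (‖v‖ • n) + ‖v‖ ^ 2 := by
      rw [hq, norm_add_sq_real, hnn]
    have h2 : 0 ≤ inner ℝ m (‖v‖ • n) := by
      rw [inner_smul_right]
      positivity
    have h3 : ‖x‖ ^ 2 = ‖m‖ ^ 2 + 2 * inner ℝ m v + ‖v‖ ^ 2 := by rw [hxm, norm_add_sq_real]
    have h4 : ‖y‖ ^ 2 = ‖m‖ ^ 2 - 2 * inner ℝ m v + ‖v‖ ^ 2 := by rw [hym, norm_sub_sq_real]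
    refine le_of_sq_le_sq ?_ (norm_nonneg _)
    nlinarith
  -- The norm passes the value `s` on the way from `p` to `q`; convexity of balls keeps this path
  -- deep inside the lune.
  have hivt : s ∈ (fun w : E => ‖w‖) '' segment ℝ p q :=
    (convex_segment p q).isPreconnected.intermediate_value (left_mem_segment ℝ p q)
      (right_mem_segment ℝ p q) continuous_norm.continuousOn ⟨by linarith, hqs⟩
  obtain ⟨w, hw, hws⟩ := hivt
  refine ⟨w, hws, ?_, ?_⟩
  · exact (convex_closedBall x (dist x y - 5 * ε)).segment_subset
      (Metric.mem_closedBall.2 (by rw [dist_comm]; linarith)) (Metric.mem_closedBall.2 hqx) hw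
  · exact (convex_closedBall y (dist x y - 5 * ε)).segment_subset
      (Metric.mem_closedBall.2 (by linarith)) (Metric.mem_closedBall.2 hqy) hw

/-- An edge reaching below `R - 10 * ε` has in its lune a point `w` of norm `R - ε`, with margin `5
* ε`. A node lies within `3 * ε` of `w`: `ε` to the sphere, `ε` to the net, `ε` to the node. It
blocks the edge. -/
theorem IsNearIn.le_norm_of_mem_relNbhdSet {d : ℕ} (hd : 2 ≤ d)
    {F : Set (EuclideanSpace ℝ (Fin d))} {ε R : ℝ} (hε : 0 < ε) (hεR : ε < R)
    (hF : ∀ p ∈ F, ‖p‖ = R) (hnet : ∀ x, ‖x‖ = R → ∃ p ∈ F, dist x p < ε)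
    {φ : PointConfig d} (hφ : IsNearIn F ε R φ) {y : EuclideanSpace ℝ (Fin d)}
    (hy : y ∈ relNbhdSet φ.carrier) : R - 10 * ε ≤ ‖y‖ := by
  have hnode : ∀ a ∈ φ.carrier, R - ε ≤ ‖a‖ := fun a ha => by
    by_contra! hcon
    obtain ⟨p, hp, hap⟩ := hφ.2 a ha (by linarith)
    have := norm_le_norm_add_norm_sub a p
    rw [hF p hp, ← dist_eq_norm] at this
    linarith
  rcases mem_relNbhdSet.1 hy with hy | ⟨a, b, hab, hy⟩
  · linarith [hnode y hy]
  · by_contra! hcon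
    obtain ⟨w, hw, hwa, hwb⟩ := exists_norm_eq_dist_le (E := EuclideanSpace ℝ (Fin d))
      (by simpa using hd) (by linarith) hε.le (hnode a hab.1) (hnode b hab.2.1) hy (by linarith)
    have hw0 : w ≠ 0 := by
      rw [← norm_ne_zero_iff, hw]
      linarith
    obtain ⟨p, hp, hwp⟩ := hnet ((R / ‖w‖) • w) (by
      rw [norm_smul, norm_div, norm_norm, div_mul_cancel₀ _ (norm_ne_zero_iff.2 hw0),
        Real.norm_of_nonneg (by linarith)])
    obtain ⟨z, hz, hzp⟩ := hφ.1 p hp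
    have h1 := dist_div_smul_self hw0 R
    rw [hw, abs_of_neg (by linarith)] at h1
    rw [hw] at hwp
    have h2 := dist_triangle w ((R / (R - ε)) • w) z
    have h2' := dist_triangle_right ((R / (R - ε)) • w) z p
    have h3 := dist_triangle_left a z w
    have h4 := dist_triangle_left b z w
    rcases hab.not_blocked hz (by linarith) (by linarith) with rfl | rfl
    · rw [dist_comm] at h4; linarith
    · linarith

/-! ### Configurations whose graph follows a line near the origin -/

theorem EuclideanSpace.norm_sq_fin_three (v : EuclideanSpace ℝ (Fin 3)) :
    ‖v‖ ^ 2 = v 0 ^ 2 + v 1 ^ 2 + v 2 ^ 2 := by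
  rw [EuclideanSpace.real_norm_sq_eq, Fin.sum_univ_three]

theorem EuclideanSpace.abs_apply_le_norm {ι : Type*} [Fintype ι] (v : EuclideanSpace ℝ ι) (i : ι) :
    |v i| ≤ ‖v‖ :=
  PiLp.norm_apply_le v i

/-- Three collinear points and four points off the line that block edges leaving the origin. -/
def lineBlockers (a : ℝ) : Set (EuclideanSpace ℝ (Fin 3)) :=
  {0, !₂[a, 0, 0], !₂[-a, 0, 0], !₂[a, a, 0], !₂[a, -a, 0], !₂[a, 0, a], !₂[a, 0, -a]}

theorem finite_lineBlockers (a : ℝ) : (lineBlockers a).Finite := by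
  simp [lineBlockers]

theorem le_norm_of_mem_lineBlockers {a : ℝ} {p : EuclideanSpace ℝ (Fin 3)}
    (hp : p ∈ lineBlockers a) (hp0 : p ≠ 0) : a ≤ ‖p‖ := by
  have h0 := (le_abs_self _).trans (EuclideanSpace.abs_apply_le_norm p 0)
  have h0' := (neg_le_abs _).trans (EuclideanSpace.abs_apply_le_norm p 0)
  rcases hp with rfl | rfl | rfl | rfl | rfl | rfl | rfl
  · exact absurd rfl hp0
  · simpa using h0
  · simpa using h0'
  all_goals simpa using h0

/-- Every point that is near one of the last four points of `lineBlockers a`, or far from the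
origin, is nearer to some point of `lineBlockers a` than to the origin. -/
theorem exists_mem_lineBlockers_dist_le {a ε : ℝ} (hε : 0 < ε) (hεa : 100 * ε ≤ a)
    {y : EuclideanSpace ℝ (Fin 3)}
    (hy : 5 * a < ‖y‖ ∨ (a - ε < y 0 ∧ 1.4 * a - ε < ‖y‖ ∧ ‖y‖ < 1.5 * a + ε)) :
    ∃ p ∈ lineBlockers a, a ≤ ‖p‖ ∧ ‖p‖ + 4 * ε ≤ ‖y‖ ∧ dist y p ≤ ‖y‖ - 2 * ε := by
  have ha : 0 < a := by linarith
  have hyn := EuclideanSpace.norm_sq_fin_three y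
  have hN : a + 4 * ε ≤ ‖y‖ := by rcases hy with h | ⟨_, h, _⟩ <;> linarith
  -- Expanding squares, `dist y p ≤ ‖y‖ - 2 * ε` follows from `‖p‖ ^ 2 + 4 * ε * ‖y‖ ≤ 2 * ⟪p, y⟫`,
  -- so each case only needs a `p` with large inner product with `y`.
  have key : ∀ p : EuclideanSpace ℝ (Fin 3), p ∈ lineBlockers a → p ≠ 0 → ‖p‖ + 4 * ε ≤ ‖y‖ →
      p 0 ^ 2 + p 1 ^ 2 + p 2 ^ 2 + 4 * ε * ‖y‖ ≤ 2 * (p 0 * y 0 + p 1 * y 1 + p 2 * y 2) →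
      ∃ p ∈ lineBlockers a, a ≤ ‖p‖ ∧ ‖p‖ + 4 * ε ≤ ‖y‖ ∧ dist y p ≤ ‖y‖ - 2 * ε := by
    intro p hp hp0 hpy h
    refine ⟨p, hp, le_norm_of_mem_lineBlockers hp hp0, hpy, ?_⟩
    refine le_of_sq_le_sq ?_ (by linarith)
    rw [dist_eq_norm, EuclideanSpace.norm_sq_fin_three]
    simp only [PiLp.sub_apply]
    nlinarith
  have norm1 : ∀ p : EuclideanSpace ℝ (Fin 3), p 0 ^ 2 + p 1 ^ 2 + p 2 ^ 2 = a ^ 2 → ‖p‖ ≤ a :=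
    fun p hp => le_of_sq_le_sq (by rw [EuclideanSpace.norm_sq_fin_three, hp]) ha.le
  have norm2 : ∀ p : EuclideanSpace ℝ (Fin 3), p 0 ^ 2 + p 1 ^ 2 + p 2 ^ 2 = 2 * a ^ 2 →
      ‖p‖ ≤ 2 * a := fun p hp =>
    le_of_sq_le_sq (by rw [EuclideanSpace.norm_sq_fin_three, hp]; nlinarith) (by linarith)
  have nz : ∀ p : EuclideanSpace ℝ (Fin 3), p 0 ≠ 0 → p ≠ 0 := by
    rintro p hp rfl
    exact hp rfl
  rcases hy with hy | ⟨h0, -, hN'⟩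
  · have hεN : 4 * ε * ‖y‖ ≤ a * ‖y‖ / 25 := by nlinarith
    have haN : 5 * (a * a) ≤ a * ‖y‖ := by nlinarith
    have haa : 0 ≤ a * a := mul_self_nonneg a
    by_cases h0 : ‖y‖ / 4 ≤ |y 0|
    · rcases le_abs.1 h0 with h | h
      · refine key !₂[a, 0, 0] (by simp [lineBlockers]) (nz _ (by simpa using ha.ne')) ?_ ?_
        · linarith [norm1 !₂[a, 0, 0] (by simp)]
        · have := mul_le_mul_of_nonneg_left h ha.le
          simp
          linarith
      · refine key !₂[-a, 0, 0] (by simp [lineBlockers]) (nz _ (by simpa using ha.ne')) ?_ ?_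
        · linarith [norm1 !₂[-a, 0, 0] (by simp)]
        · have := mul_le_mul_of_nonneg_left h ha.le
          simp
          linarith
    · rw [not_le, abs_lt] at h0
      have h0a := mul_le_mul_of_nonneg_left h0.1.le ha.le
      -- Otherwise the squared norm would be less than `(1 / 16 + 2 * 0.68 ^ 2) * ‖y‖ ^ 2`, and this
      -- factor is below `1`.
      have h12 : 0.68 * ‖y‖ ≤ |y 1| ∨ 0.68 * ‖y‖ ≤ |y 2| := by
        by_contra! hcon
        have h1 := sq_lt_sq' (by linarith [abs_nonneg (y 1), norm_nonneg y]) hcon.1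
        have h2 := sq_lt_sq' (by linarith [abs_nonneg (y 2), norm_nonneg y]) hcon.2
        have h3 := sq_lt_sq' h0.1 h0.2
        rw [sq_abs] at h1 h2
        nlinarith
      rcases h12 with h | h <;> rcases le_abs.1 h with h | h <;>
        have h1a := mul_le_mul_of_nonneg_left h ha.le
      · refine key !₂[a, a, 0] (by simp [lineBlockers]) (nz _ (by simpa using ha.ne')) ?_ ?_
        · linarith [norm2 !₂[a, a, 0] (by simp; ring)]
        · simp
          linarith
      · refine key !₂[a, -a, 0] (by simp [lineBlockers]) (nz _ (by simpa using ha.ne')) ?_ ?_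
        · linarith [norm2 !₂[a, -a, 0] (by simp; ring)]
        · simp
          linarith
      · refine key !₂[a, 0, a] (by simp [lineBlockers]) (nz _ (by simpa using ha.ne')) ?_ ?_
        · linarith [norm2 !₂[a, 0, a] (by simp; ring)]
        · simp
          linarith
      · refine key !₂[a, 0, -a] (by simp [lineBlockers]) (nz _ (by simpa using ha.ne')) ?_ ?_
        · linarith [norm2 !₂[a, 0, -a] (by simp; ring)]
        · simp
          linarith
  · refine key !₂[a, 0, 0] (by simp [lineBlockers]) (nz _ (by simpa using ha.ne')) ?_ ?_
    · linarith [norm1 !₂[a, 0, 0] (by simp)]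
    · simp
      nlinarith

/-- The outer alternatives separate nodes that may end an edge from near the origin from those that
are blocked. Nodes beyond `5 * a` are uncontrolled and belong to the second kind; the numbers `1.4`
and `1.5` enclose `√2`. -/
theorem exists_mem_lineBlockers_cases {a ε : ℝ} (hε : 0 < ε) (hεa : 100 * ε ≤ a)
    {x : EuclideanSpace ℝ (Fin 3)} (hx : ‖x‖ ≤ 5 * a → ∃ p ∈ lineBlockers a, dist x p < ε) :
    (‖x‖ < ε ∨ (a - ε ≤ ‖x‖ ∧ |x 1| ≤ ε)) ∨
      (5 * a < ‖x‖ ∨ (a - ε < x 0 ∧ 1.4 * a - ε < ‖x‖ ∧ ‖x‖ < 1.5 * a + ε)) := by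
  by_cases hxa : 5 * a < ‖x‖
  · exact Or.inr (Or.inl hxa)
  obtain ⟨p, hp, hxp⟩ := hx (not_lt.1 hxa)
  rw [dist_eq_norm] at hxp
  have h0 := (EuclideanSpace.abs_apply_le_norm (x - p) 0).trans_lt hxp
  have h1 := (EuclideanSpace.abs_apply_le_norm (x - p) 1).trans_lt hxp
  have hn := (abs_norm_sub_norm_le x p).trans_lt hxp
  have hp' := le_norm_of_mem_lineBlockers hp
  have hpn := EuclideanSpace.norm_sq_fin_three p
  rw [abs_lt] at hn h0
  have far : p 0 = a → p 0 ^ 2 + p 1 ^ 2 + p 2 ^ 2 = 2 * a ^ 2 →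
      (a - ε < x 0 ∧ 1.4 * a - ε < ‖x‖ ∧ ‖x‖ < 1.5 * a + ε) := by
    intro h h'
    have l1 : 1.4 * a ≤ ‖p‖ := le_of_sq_le_sq (by rw [hpn, h']; nlinarith) (norm_nonneg _)
    have l2 : ‖p‖ ≤ 1.5 * a := le_of_sq_le_sq (by rw [hpn, h']; nlinarith) (by linarith)
    simp only [PiLp.sub_apply] at h0
    exact ⟨by linarith, by linarith, by linarith⟩
  have near : p 1 = 0 → a ≤ ‖p‖ → (a - ε ≤ ‖x‖ ∧ |x 1| ≤ ε) := by
    intro h h'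
    simp only [PiLp.sub_apply, h, sub_zero] at h1
    exact ⟨by linarith, h1.le⟩
  have ha : a ≠ 0 := by linarith
  have nz : ∀ p : EuclideanSpace ℝ (Fin 3), p 0 ≠ 0 → p ≠ 0 := by
    rintro p hp rfl
    exact hp rfl
  rcases hp with rfl | rfl | rfl | rfl | rfl | rfl | rfl
  · exact Or.inl (Or.inl (by simpa using hxp))
  · exact Or.inl (Or.inr (near (by simp) (hp' (nz _ (by simpa using ha)))))
  · exact Or.inl (Or.inr (near (by simp) (hp' (nz _ (by simpa using ha)))))
  all_goals exact Or.inr (Or.inr (far (by simp) (by simp; ring)))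

theorem IsRelNbhdEdge.symm {d : ℕ} {φ : Set (EuclideanSpace ℝ (Fin d))}
    {x y : EuclideanSpace ℝ (Fin d)} (h : IsRelNbhdEdge φ x y) : IsRelNbhdEdge φ y x :=
  ⟨h.2.1, h.1, h.2.2.1.symm, fun z hz hzy hzx => by
    rw [max_comm, dist_comm]
    exact h.2.2.2 z hz hzx hzy⟩

/-- If the other end also has small coordinate `1`, convexity suffices. Any other end `y` is cut off
from `x` by the node near a suitable blocker. -/
theorem IsNearIn.abs_apply_one_le_of_mem_segment {a ε : ℝ} (hε : 0 < ε) (hεa : 100 * ε ≤ a)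
    {φ : PointConfig 3} (hφ : IsNearIn (lineBlockers a) ε (5 * a) φ)
    {x y w : EuclideanSpace ℝ (Fin 3)} (h : IsRelNbhdEdge φ.carrier x y) (hx : ‖x‖ < ε)
    (hw : w ∈ segment ℝ x y) : |w 1| ≤ ε := by
  have hx1 : |x 1| ≤ ε := (EuclideanSpace.abs_apply_le_norm x 1).trans hx.le
  have convex : |y 1| ≤ ε → |w 1| ≤ ε := by
    intro hy1
    obtain ⟨t, u, ht, hu, htu, rfl⟩ := hw
    simp only [PiLp.add_apply, PiLp.smul_apply, smul_eq_mul]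
    rw [abs_le] at *
    constructor <;> nlinarith
  rcases exists_mem_lineBlockers_cases hε hεa (hφ.2 y h.2.1) with (hy | ⟨-, hy⟩) | hy
  · exact convex ((EuclideanSpace.abs_apply_le_norm y 1).trans hy.le)
  · exact convex hy
  · exfalso
    obtain ⟨p, hp, hpa, hpy, hyp⟩ := exists_mem_lineBlockers_dist_le hε hεa hy
    obtain ⟨z, hz, hzp⟩ := hφ.1 p hp
    have h1 := dist_triangle_right x z p
    have h2 := dist_triangle_right y z p
    have h3 : dist x p ≤ ‖x‖ + ‖p‖ := dist_le_norm_add_norm x p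
    have h4 := norm_le_norm_add_norm_sub x y
    rw [← dist_eq_norm] at h4
    have h5 := norm_le_norm_add_norm_sub z p
    rw [← dist_eq_norm] at h5
    rcases h.not_blocked hz (by linarith) (by linarith) with rfl | rfl
    · linarith
    · linarith

/-- An edge with both ends far away that passes within `q` of the origin is nearly as long as the
sum of the norms of its ends, so the node near the origin blocks it. Only edges with an end near the
origin remain. -/
theorem IsNearIn.abs_apply_one_le_of_mem_relNbhdSet {a ε q : ℝ} (hε : 0 < ε) (hεa : 100 * ε ≤ a)
    (hq : 2 * q + 3 * ε ≤ a) {φ : PointConfig 3} (hφ : IsNearIn (lineBlockers a) ε (5 * a) φ)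
    {w : EuclideanSpace ℝ (Fin 3)} (hw : w ∈ relNbhdSet φ.carrier) (hwq : ‖w‖ ≤ q) :
    |w 1| ≤ ε := by
  have cases : ∀ x ∈ φ.carrier, ‖x‖ < ε ∨ a - ε ≤ ‖x‖ := fun x hx => by
    rcases exists_mem_lineBlockers_cases hε hεa (hφ.2 x hx) with (h | ⟨h, -⟩) | h | ⟨-, h, -⟩
    · exact Or.inl h
    · exact Or.inr h
    · exact Or.inr (by linarith)
    · exact Or.inr (by linarith)
  rcases mem_relNbhdSet.1 hw with hw | ⟨x, y, h, hw⟩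
  · rcases cases w hw with h | h
    · exact (EuclideanSpace.abs_apply_le_norm w 1).trans h.le
    · linarith [norm_nonneg w]
  · rcases cases x h.1 with hx | hx
    · exact hφ.abs_apply_one_le_of_mem_segment hε hεa h hx hw
    rcases cases y h.2.1 with hy | hy
    · exact hφ.abs_apply_one_le_of_mem_segment hε hεa h.symm hy (by rwa [segment_symm])
    exfalso
    obtain ⟨z, hz, hz0⟩ := hφ.1 0 (Or.inl rfl)
    rw [dist_zero_right] at hz0
    have hxy : dist x w + dist w y = dist x y := dist_add_dist_of_mem_segment hw
    have h1 := norm_le_norm_add_norm_sub' x w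
    have h2 := norm_le_norm_add_norm_sub' y w
    rw [← dist_eq_norm] at h1 h2
    rw [dist_comm y w] at h2
    have h3 := dist_le_norm_add_norm x z
    have h4 := dist_le_norm_add_norm y z
    rcases h.not_blocked hz (by linarith) (by linarith) with rfl | rfl
    · linarith
    · linarith

/-! ### Erosions and openings of the Voronoi mollification -/

theorem closedBall_subset_voronoiMollification {d : ℕ} {ι : Type*} {i : ι}
    {Φ : ι → Set (EuclideanSpace ℝ (Fin d))} {r s : ℝ} (hi : ∃ z ∈ Φ i, ‖z‖ ≤ s)
    (h : ∀ j ≠ i, ∀ y ∈ relNbhdSet (Φ j), 2 * r + s ≤ ‖y‖) :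
    Metric.closedBall 0 r ⊆ voronoiMollification i Φ := by
  intro x hx
  rw [mem_closedBall_zero_iff] at hx
  obtain ⟨z, hz, hzs⟩ := hi
  show Metric.infEDist x (relNbhdSet (Φ i)) ≤ ⨅ j, Metric.infEDist x (relNbhdSet (Φ j))
  refine le_iInf fun j => ?_
  by_cases hj : j = i
  · rw [hj]
  calc Metric.infEDist x (relNbhdSet (Φ i)) ≤ edist x z :=
        Metric.infEDist_le_edist_of_mem (mem_relNbhdSet.2 (Or.inl hz))
    _ ≤ ENNReal.ofReal (r + s) := by
        rw [edist_dist]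
        exact ENNReal.ofReal_le_ofReal ((dist_le_norm_add_norm x z).trans (add_le_add hx hzs))
    _ ≤ Metric.infEDist x (relNbhdSet (Φ j)) := by
        refine Metric.le_infEDist.2 fun y hy => ?_
        rw [edist_dist]
        refine ENNReal.ofReal_le_ofReal ?_
        have h1 := h j hj y hy
        have h2 := norm_le_norm_add_norm_sub x y
        rw [← dist_eq_norm] at h2
        linarith

theorem notMem_voronoiMollification {d : ℕ} {ι : Type*} {i j : ι}
    {Φ : ι → Set (EuclideanSpace ℝ (Fin d))} {x z : EuclideanSpace ℝ (Fin d)} {s : ℝ}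
    (hz : z ∈ Φ j) (hxz : dist x z < s) (h : ∀ y ∈ relNbhdSet (Φ i), s ≤ dist x y) :
    x ∉ voronoiMollification i Φ := by
  intro hx
  have h1 : Metric.infEDist x (relNbhdSet (Φ i)) ≤ edist x z :=
    (hx.trans (iInf_le _ j)).trans
      (Metric.infEDist_le_edist_of_mem (mem_relNbhdSet.2 (Or.inl hz)))
  have h2 : ENNReal.ofReal s ≤ Metric.infEDist x (relNbhdSet (Φ i)) :=
    Metric.le_infEDist.2 fun y hy => by
      rw [edist_dist]
      exact ENNReal.ofReal_le_ofReal (h y hy)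
  rw [edist_dist] at h1
  exact absurd (h2.trans h1)
    (not_le.2 ((ENNReal.ofReal_lt_ofReal_iff (dist_nonneg.trans_lt hxz)).2 hxz))

/-- A closed ball of radius `r` that contains the origin contains a point whose second coordinate has
absolute value at least `r`. -/
theorem exists_mem_closedBall_le_abs_apply_one {r : ℝ} (hr : 0 < r)
    {y : EuclideanSpace ℝ (Fin 3)} (hy : ‖y‖ ≤ r) :
    ∃ z ∈ Metric.closedBall y r, r ≤ |z 1| ∧ ‖z‖ ≤ 2 * r := by
  have hn : ∀ z : EuclideanSpace ℝ (Fin 3), z ∈ Metric.closedBall y r → ‖z‖ ≤ 2 * r := by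
    intro z hz
    rw [Metric.mem_closedBall, dist_eq_norm] at hz
    linarith [norm_le_norm_add_norm_sub' z y]
  have hm : ∀ t : ℝ, |t| = r →
      y + EuclideanSpace.single 1 t ∈ Metric.closedBall y r := by
    intro t ht
    rw [Metric.mem_closedBall, dist_self_add_left, PiLp.norm_single,
      Real.norm_eq_abs, ht]
  rcases le_total 0 (y 1) with h | h
  · have := hm r (abs_of_pos hr)
    refine ⟨_, this, le_abs.2 (Or.inl ?_), hn _ this⟩
    simpa using h
  · have := hm (-r) (by rw [abs_neg, abs_of_pos hr])
    refine ⟨_, this, le_abs.2 (Or.inr ?_), hn _ this⟩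
    simp
    linarith

theorem zero_mem_erosion_diff_opening {ι : Type*} {i j : ι} (hij : j ≠ i)
    {X : ι → PointConfig 3} {F : Set (EuclideanSpace ℝ (Fin 3))} {r₁ r₂ ε : ℝ}
    (hε : 0 < ε) (hε₁ : 20 * ε ≤ r₁) (hε₂ : 20 * ε ≤ r₂ - r₁)
    (hF : ∀ p ∈ F, ‖p‖ = r₁ + r₂) (hnet : ∀ x, ‖x‖ = r₁ + r₂ → ∃ p ∈ F, dist x p < ε)
    (hi : IsNearIn (lineBlockers (10 * r₂)) ε (5 * (10 * r₂)) (X i))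
    (hj : ∀ j ≠ i, IsNearIn F ε (r₁ + r₂) (X j)) :
    0 ∈ erosion r₁ (voronoiMollification i fun j => (X j).carrier) \
      opening r₂ (voronoiMollification i fun j => (X j).carrier) := by
  constructor
  · refine closedBall_subset_voronoiMollification (s := ε) ?_ fun j hji y hy => ?_
    · obtain ⟨z, hz, hz0⟩ := hi.1 0 (Or.inl rfl)
      rw [dist_zero_right] at hz0
      exact ⟨z, hz, hz0.le⟩
    · have := (hj j hji).le_norm_of_mem_relNbhdSet (by norm_num) hε (by linarith) hF hnet hy
      linarith
  · rw [mem_opening_zero_iff]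
    rintro ⟨y, hy, hsub⟩
    obtain ⟨z, hzy, hz1, hz2⟩ := exists_mem_closedBall_le_abs_apply_one (by linarith) hy
    have hzn : r₂ ≤ ‖z‖ := hz1.trans (EuclideanSpace.abs_apply_le_norm z 1)
    have hz0 : z ≠ 0 := by
      rw [← norm_pos_iff]
      linarith
    obtain ⟨p, hp, hzp⟩ := hnet (((r₁ + r₂) / ‖z‖) • z) (by
      rw [norm_smul, norm_div, norm_norm, div_mul_cancel₀ _ (norm_ne_zero_iff.2 hz0),
        Real.norm_of_nonneg (by linarith)])
    obtain ⟨b, hb, hbp⟩ := (hj j hij).1 p hp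
    have hzb : dist z b < r₂ - ε := by
      have h1 := dist_div_smul_self hz0 (r₁ + r₂)
      have h2 := dist_triangle z (((r₁ + r₂) / ‖z‖) • z) b
      have h3 := dist_triangle_right (((r₁ + r₂) / ‖z‖) • z) b p
      -- From `r₂ ≤ ‖z‖ ≤ 2 * r₂` the difference lies between `-r₁` and `r₂ - r₁`; the two bounds on
      -- `ε` treat the two ends.
      have h4 : |‖z‖ - (r₁ + r₂)| ≤ r₂ - 20 * ε := abs_le.2 ⟨by linarith, by linarith⟩
      linarith
    refine notMem_voronoiMollification (i := i) (Φ := fun j => (X j).carrier) hb hzb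
      (fun g hg => ?_) (hsub hzy)
    -- Within `4 * r₂` the first graph is flat, as `2 * (4 * r₂) + 3 * ε ≤ 10 * r₂`; beyond that it
    -- is too far from `z`, whose norm is at most `2 * r₂`.
    by_cases hgn : ‖g‖ ≤ 4 * r₂
    · have h1 := hi.abs_apply_one_le_of_mem_relNbhdSet hε (by linarith) (by linarith) hg hgn
      have h2 := EuclideanSpace.abs_apply_le_norm (z - g) 1
      rw [← dist_eq_norm, PiLp.sub_apply] at h2
      linarith [abs_sub_abs_le_abs_sub (z 1) (g 1)]
    · have h2 := norm_le_norm_add_norm_sub z g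
      rw [← dist_eq_norm] at h2
      linarith

theorem exists_finite_net_sphere {d : ℕ} (R : ℝ) {ε : ℝ} (hε : 0 < ε) :
    ∃ F : Set (EuclideanSpace ℝ (Fin d)), F.Finite ∧ (∀ p ∈ F, ‖p‖ = R) ∧
      ∀ x, ‖x‖ = R → ∃ p ∈ F, dist x p < ε := by
  obtain ⟨F, hF, hfin, hcov⟩ :=
    (isCompact_sphere (0 : EuclideanSpace ℝ (Fin d)) R).finite_cover_balls hε
  refine ⟨F, hfin, fun p hp => by simpa using hF hp, fun x hx => ?_⟩
  have := hcov (mem_sphere_zero_iff_norm.2 hx)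
  simpa using this

theorem iIndepFun.measure_iInter_preimage_pos {Ω ι : Type*} [MeasurableSpace Ω] [Fintype ι]
    {β : ι → Type*} [∀ i, MeasurableSpace (β i)] {P : Measure Ω} {X : ∀ i, Ω → β i}
    (hX : iIndepFun X P) {A : ∀ i, Set (β i)} (hA : ∀ i, MeasurableSet (A i))
    (hpos : ∀ i, 0 < P (X i ⁻¹' A i)) : 0 < P (⋂ i, X i ⁻¹' A i) := by
  have := hX.measure_inter_preimage_eq_mul Finset.univ (sets := A) fun i _ => hA i
  simp only [Finset.mem_univ, iInter_true] at this
  rw [this, pos_iff_ne_zero, Finset.prod_ne_zero_iff]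
  exact fun i _ => (hpos i).ne'

theorem mainTheorem8 {Ω : Type*} [MeasurableSpace Ω] (P : Measure Ω) [IsProbabilityMeasure P]
    (k : ℕ) (hk : 2 ≤ k) (lam : Fin k → ℝ≥0) (hlam : ∀ i, 0 < lam i)
    (X : Fin k → Ω → PointConfig 3)
    (hX : ∀ i, IsPoissonProcess P (lam i) (X i))
    (hindep : iIndepFun X P)
    (Ξ : Ω → Set (EuclideanSpace ℝ (Fin 3)))
    (hΞ : ∀ ω, Ξ ω = voronoiMollification (⟨0, by omega⟩ : Fin k) (fun j => (X j ω).carrier))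
    (r₁ r₂ : ℝ) (hr₁ : 0 < r₁) (hr₁₂ : r₁ < r₂) :
    NullMeasurableSet
        {ω | (0 : EuclideanSpace ℝ (Fin 3)) ∈ erosion r₁ (Ξ ω) \ opening r₂ (Ξ ω)} P ∧
      0 < P {ω | (0 : EuclideanSpace ℝ (Fin 3)) ∈ erosion r₁ (Ξ ω) \ opening r₂ (Ξ ω)} := by
  simp only [hΞ]
  refine ⟨(measurableSet_zero_mem_erosion_diff_opening (fun i => (hX i).measurable) _ hr₁
    (hr₁.trans hr₁₂)).nullMeasurableSet, ?_⟩
  set i₀ : Fin k := ⟨0, by omega⟩ with hi₀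
  let i₁ : Fin k := ⟨1, by omega⟩
  have hi₁ : i₁ ≠ i₀ := by simp [i₁, i₀]
  obtain ⟨ε, hε, hε₁, hε₂⟩ : ∃ ε : ℝ, 0 < ε ∧ 20 * ε ≤ r₁ ∧ 20 * ε ≤ r₂ - r₁ := by
    have h1 := min_le_left r₁ (r₂ - r₁)
    have h2 := min_le_right r₁ (r₂ - r₁)
    have h3 : 0 < min r₁ (r₂ - r₁) := lt_min hr₁ (by linarith)
    exact ⟨min r₁ (r₂ - r₁) / 20, by linarith, by linarith, by linarith⟩
  obtain ⟨F, hfin, hF, hnet⟩ := exists_finite_net_sphere (d := 3) (r₁ + r₂) hε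
  obtain ⟨A, hA, hAnear, hApos⟩ :=
    exists_measurableSet_isNearIn (finite_lineBlockers (10 * r₂)) hε (5 * (10 * r₂))
  obtain ⟨B, hB, hBnear, hBpos⟩ := exists_measurableSet_isNearIn hfin hε (r₁ + r₂)
  let C : Fin k → Set (PointConfig 3) := fun i => if i = i₀ then A else B
  have hC : ∀ i, MeasurableSet (C i) := fun i => by
    by_cases h : i = i₀ <;> simp [C, h, hA, hB]
  have hCpos : ∀ i, 0 < P (X i ⁻¹' C i) := fun i => by
    by_cases h : i = i₀
    · simpa [C, h] using hApos (hX i₀) (hlam i₀)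
    · simpa [C, h] using hBpos (hX i) (hlam i)
  refine (iIndepFun.measure_iInter_preimage_pos hindep hC hCpos).trans_le
    (measure_mono fun ω hω => ?_)
  rw [mem_iInter] at hω
  refine zero_mem_erosion_diff_opening hi₁ (X := fun j => X j ω) hε hε₁ hε₂ hF hnet
    (hAnear _ ?_) fun j hj => hBnear _ ?_
  · simpa [C] using hω i₀
  · simpa [C, hj] using hω j
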